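/- **Theorem (Convergence of DNWR, asymmetric decomposition).** Let $a,b,c,T>0$ with $a\neq b$, and let $u$ solve $$\partial_{tt}u-c^2\partial_{xx}u=f\ \text{in }(-a,b)\times(0,T),\quad u(\cdot,0)=u_0,\ \partial_t u(\cdot,0)=v_0,\quad u(-a,\cdot)=g_l,\ u(b,\cdot)=g_r .$$ Given an initial guess $h^0$ on $(0,T)$, the Dirichlet–Neumann waveform relaxation (DNWR) algorithm with relaxation parameter $\theta$ computes for $k=1,2,\dots$: a function $u_1^k$ with $\partial_{tt}u_1^k-c^2\partial_{xx}u_1^k=f$ in $(-a,0)\times(0,T)$, initial data $u_0,v_0$, $u_1^k(-a,\cdot)=g_l$ and $u_1^k(0,\cdot)=h^{k-1}$; a function $u_2^k$ with $\partial_{tt}u_2^k-c^2\partial_{xx}u_2^k=f$ in $(0,b)\times(0,T)$, initial data $u_0,v_0$, $u_2^k(b,\cdot)=g_r$ and $\partial_x u_2^k(0,\cdot)=\partial_x u_1^k(0,\cdot)$; and $$h^k=\theta\,u_2^k(0,\cdot)+(1-\theta)\,h^{k-1}\quad\text{on }(0,T).$$ Here $f$, $u_0$, $v_0$, $g_l$,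 $g_r$, $h^0$, the iterates $u_i^k$ with their boundary values, and $u$ are integrable functions, and the equations together with the initial and boundary conditions are understood in the very weak sense: in Green's formula (two integrations by parts) against all smooth test functions vanishing for $t$ near and beyond $T$, where the normal derivatives at the end points are linear functionals on test functions of time. Let $\theta=\tfrac12$, and let $k\ge 1$ be an integer with $$\frac{T}{k}\le 2\min\Big\{\frac ac,\frac bc\Big\}.$$ Then the interface error vanishes from step $k$ on: for every $j\ge k$, $u$ has the interface value $u(0,\cdot)=h^j$, and this value is unique, so that $h^j-u(0,\cdot)=0$ a.e. on $(0,T)$. Consequently the algorithm converges in at most $k+1$ iterations: for every $j\ge k$, $u_1^{j+1}=u$ a.e. in $(-a,0)\times(0,T)$ and $u_2^{j+1}=u$ a.e. in $(0,b)\times(0,T)$. -/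

import Mathlib

open scoped ContDiff

namespace DNWR

open MeasureTheory Set

/-- Test functions of time: smooth functions that vanish near and after the final time `T`
(no condition is imposed at `t = 0`). -/
def timeTest (T : ℝ) : Submodule ℝ (ℝ → ℝ) where
  carrier := {χ | ContDiff ℝ ∞ χ ∧ ∃ T' < T, ∀ t, T' ≤ t → χ t = 0}
  zero_mem' := ⟨contDiff_const, T - 1, by linarith, fun _ _ => rfl⟩
  add_mem' := by
    rintro χ ψ ⟨hχ, S, hS, hχ0⟩ ⟨hψ, R, hR, hψ0⟩
    refine ⟨hχ.add hψ, max S R, max_lt hS hR, fun t ht => ?_⟩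
    simp [hχ0 t ((le_max_left _ _).trans ht), hψ0 t ((le_max_right _ _).trans ht)]
  smul_mem' := by
    rintro r χ ⟨hχ, S, hS, hχ0⟩
    exact ⟨contDiff_const.smul hχ, S, hS, fun t ht => by simp [hχ0 t ht]⟩

/-- Normal derivatives on a boundary point, as functions of time in the distributional sense:
linear functionals on the test functions of time.  An integrable normal derivative `g` is the
functional `χ ↦ ∫ t in 0..T, g t * χ t`. -/
abbrev Flux (T : ℝ) : Type := timeTest T →ₗ[ℝ] ℝ

/-- Space-time test functions `φ x t`: smooth, and zero near and after the final time `T`. -/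
structure TestFn (T : ℝ) where
  /-- the function, with space as first and time as second variable -/
  toFun : ℝ → ℝ → ℝ
  smooth : ContDiff ℝ ∞ (fun z : ℝ × ℝ => toFun z.1 z.2)
  vanish : ∃ T' < T, ∀ x t, T' ≤ t → toFun x t = 0

namespace TestFn

variable {T : ℝ}

/-- The restriction `φ(x, ·)` of a test function to a fixed point `x` of space. -/
def slice (φ : TestFn T) (x : ℝ) : timeTest T :=
  ⟨φ.toFun x, by
    obtain ⟨T', hT', h⟩ := φ.vanish
    exact ⟨φ.smooth.comp (contDiff_const.prodMk contDiff_id), T', hT', h x⟩⟩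

/-- The partial derivative `∂ₓ φ(x, t)`. -/
noncomputable def dx (φ : TestFn T) (x t : ℝ) : ℝ := deriv (fun y => φ.toFun y t) x

/-- The partial derivative `∂ₜ φ(x, t)`. -/
noncomputable def dt (φ : TestFn T) (x t : ℝ) : ℝ := deriv (fun s => φ.toFun x s) t

/-- The wave operator `∂ₜₜ φ - c² ∂ₓₓ φ` at `(x, t)`. -/
noncomputable def wave (c : ℝ) (φ : TestFn T) (x t : ℝ) : ℝ :=
  iteratedDeriv 2 (fun s => φ.toFun x s) t - c ^ 2 * iteratedDeriv 2 (fun y => φ.toFun y t) x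

end TestFn

/-- `u ∈ L¹((p,q) × (0,T))` is a (very weak) solution of `∂ₜₜ u - c² ∂ₓₓ u = f` in
`(p,q) × (0,T)` with `u(·,0) = u₀` and `∂ₜ u(·,0) = v₀` on `(p,q)`, whose boundary values at
`p` and `q` are `αp` and `αq` and whose outward normal derivatives there
(that is, `-∂ₓ u(p,·)` and `∂ₓ u(q,·)`) are `νp` and `νq`.
Everything is expressed by Green's formula, obtained by multiplying the equation by a test
function and integrating by parts twice.  The test functions are not required to vanish at
`p`, at `q` or at `t = 0`, so the formula determines the boundary values, the normal
derivatives and the initial conditions. -/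
structure IsWaveSolution (c T p q : ℝ) (f : ℝ → ℝ → ℝ) (u₀ v₀ : ℝ → ℝ)
    (αp αq : ℝ → ℝ) (νp νq : Flux T) (u : ℝ → ℝ → ℝ) : Prop where
  integrable_sol :
    IntegrableOn (fun z : ℝ × ℝ => u z.1 z.2) (Ioo p q ×ˢ Ioo 0 T)
  integrable_source :
    IntegrableOn (fun z : ℝ × ℝ => f z.1 z.2) (Ioo p q ×ˢ Ioo 0 T)
  integrable_pos : IntegrableOn u₀ (Ioo p q)
  integrable_vel : IntegrableOn v₀ (Ioo p q)
  integrable_left : IntegrableOn αp (Ioo 0 T)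
  integrable_right : IntegrableOn αq (Ioo 0 T)
  green : ∀ φ : TestFn T,
    ∫ z in Ioo p q ×ˢ Ioo 0 T, u z.1 z.2 * φ.wave c z.1 z.2 =
      (∫ z in Ioo p q ×ˢ Ioo 0 T, f z.1 z.2 * φ.toFun z.1 z.2)
      + (∫ x in Ioo p q, v₀ x * φ.toFun x 0)
      - (∫ x in Ioo p q, u₀ x * φ.dt x 0)
      + c ^ 2 * (νp (φ.slice p) + ∫ t in Ioo 0 T, αp t * φ.dx p t)
      + c ^ 2 * (νq (φ.slice q) - ∫ t in Ioo 0 T, αq t * φ.dx q t)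

/-- `u` solves the model problem on the whole domain `(-a,b)` with Dirichlet data `gl` at `-a`
and `gr` at `b`. -/
def IsModelSolution (a b c T : ℝ) (f : ℝ → ℝ → ℝ) (u₀ v₀ gl gr : ℝ → ℝ)
    (u : ℝ → ℝ → ℝ) : Prop :=
  ∃ νl νr : Flux T, IsWaveSolution c T (-a) b f u₀ v₀ gl gr νl νr u

/-- The solution `u` of the model problem has the value `w` on the interface `{0} × (0,T)`:
its restrictions to the two subdomains solve the subdomain problems with the Dirichlet value `w`
at `0` from both sides (and with opposite outward normal derivatives there). -/
def HasInterfaceValue (a b c T : ℝ) (f : ℝ → ℝ → ℝ) (u₀ v₀ gl gr : ℝ → ℝ)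
    (u : ℝ → ℝ → ℝ) (w : ℝ → ℝ) : Prop :=
  ∃ νl ν νr : Flux T,
    IsWaveSolution c T (-a) 0 f u₀ v₀ gl w νl ν u ∧
    IsWaveSolution c T 0 b f u₀ v₀ w gr (-ν) νr u

/-- The Dirichlet-Neumann waveform relaxation algorithm on `(-a,0)` and `(0,b)` with relaxation
parameter `θ`: `h k` is the `k`-th interface function (`h 0` the initial guess), and
`u₁ (k+1)`, `u₂ (k+1)` are the subdomain solutions computed in iteration `k+1` from `h k`
(the entries `u₁ 0`, `u₂ 0` play no role).  In each iteration `ν₁` is the outward normal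
derivative of `u₁ (k+1)` at the interface and `τ` the interface value of `u₂ (k+1)`. -/
structure IsDNWR (a b c T θ : ℝ) (f : ℝ → ℝ → ℝ) (u₀ v₀ gl gr : ℝ → ℝ)
    (h : ℕ → ℝ → ℝ) (u₁ u₂ : ℕ → ℝ → ℝ → ℝ) : Prop where
  guess : IntegrableOn (h 0) (Ioo 0 T)
  step : ∀ k : ℕ, ∃ (νl ν₁ νr : Flux T) (τ : ℝ → ℝ),
    IsWaveSolution c T (-a) 0 f u₀ v₀ gl (h k) νl ν₁ (u₁ (k + 1)) ∧
    IsWaveSolution c T 0 b f u₀ v₀ τ gr (-ν₁) νr (u₂ (k + 1)) ∧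
    ∀ᵐ t ∂(volume.restrict (Ioo 0 T)), h (k + 1) t = θ * τ t + (1 - θ) * h k t

end DNWR

open scoped ContDiff

namespace DNWR

open MeasureTheory Set Filter

/-! ### Integrability and test functions -/

/-! Write A = a/c, B = b/c, m = 2 min(A, B), let `τ j` be the trace at 0 of `u₂ (j + 1)`, and follow
the jump d_j = `τ j` - `h j` across the interface. The plan is to show that d_j vanishes on (0, jm).
Once jm ≥ T, the two subdomain solutions share trace and flux, so they glue to a solution on the
whole domain (`IsWaveSolution.glue`), which is u by uniqueness (`IsWaveSolution.unique`). Comparing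
consecutive iterates, rather than iterates with u, avoids assuming beforehand that u has a trace at
the interface.

Eliminating the flux between the two subdomains relates the increments e of the Dirichlet value and
e' of the Neumann-side trace. With the time shift E_r by r, this is (E_2A + 1)(E_2B - 1) acting on e
plus (E_2A - 1)(E_2B + 1) acting on e', in dual form: the shifts fall on the test function
(`interface_relation`). For θ = 1/2 one has e = -d_j/2 and e' = d_j/2 - d_{j+1}, so d_j drops out of
the undelayed term. Hence d_{j+1}(t) depends only on values of d_j and d_{j+1} at least m earlier,
and the jump-free interval grows by m in each step (`jump_vanishes`).

Very weak solutions allow no energy argument. Uniqueness comes from testing with sine modes in space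
and from completeness of the sines in L¹; the interface relation comes from testing with exact
d'Alembert waves. -/

theorem integrableOn_mul_continuous {g k : ℝ → ℝ} {p q : ℝ} (hg : IntegrableOn g (Ioo p q))
    (hk : Continuous k) : IntegrableOn (fun x => g x * k x) (Ioo p q) :=
  hg.mul_continuousOn_of_subset hk.continuousOn measurableSet_Ioo isCompact_Icc Ioo_subset_Icc_self

theorem integrableOn_mul_continuous_prod {g k : ℝ × ℝ → ℝ} {p q r s : ℝ}
    (hg : IntegrableOn g (Ioo p q ×ˢ Ioo r s)) (hk : Continuous k) :
    IntegrableOn (fun z => g z * k z) (Ioo p q ×ˢ Ioo r s) :=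
  hg.mul_continuousOn_of_subset hk.continuousOn (measurableSet_Ioo.prod measurableSet_Ioo)
    (isCompact_Icc.prod isCompact_Icc)
    (prod_mono Ioo_subset_Icc_self Ioo_subset_Icc_self)

theorem contDiff_deriv_fst {Φ : ℝ → ℝ → ℝ} (h : ContDiff ℝ ∞ (fun z : ℝ × ℝ => Φ z.1 z.2)) :
    ContDiff ℝ ∞ (fun z : ℝ × ℝ => deriv (fun y => Φ y z.2) z.1) := by
  simp only [← fderiv_apply_one_eq_deriv]
  refine ContDiff.clm_apply ?_ contDiff_const
  refine ContDiff.fderiv (m := ∞) (f := fun (z : ℝ × ℝ) y => Φ y z.2) ?_ contDiff_fst le_rfl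
  exact h.comp (contDiff_snd.prodMk (contDiff_snd.comp contDiff_fst))

theorem contDiff_deriv_snd {Φ : ℝ → ℝ → ℝ} (h : ContDiff ℝ ∞ (fun z : ℝ × ℝ => Φ z.1 z.2)) :
    ContDiff ℝ ∞ (fun z : ℝ × ℝ => deriv (fun s => Φ z.1 s) z.2) := by
  simp only [← fderiv_apply_one_eq_deriv]
  refine ContDiff.clm_apply ?_ contDiff_const
  refine ContDiff.fderiv (m := ∞) (f := fun (z : ℝ × ℝ) s => Φ z.1 s) ?_ contDiff_snd le_rfl
  exact h.comp ((contDiff_fst.comp contDiff_fst).prodMk contDiff_snd)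

namespace TestFn

variable {T : ℝ}

theorem contDiff_dx (φ : TestFn T) : ContDiff ℝ ∞ (fun z : ℝ × ℝ => φ.dx z.1 z.2) :=
  contDiff_deriv_fst φ.smooth

theorem contDiff_dt (φ : TestFn T) : ContDiff ℝ ∞ (fun z : ℝ × ℝ => φ.dt z.1 z.2) :=
  contDiff_deriv_snd φ.smooth

theorem wave_eq (c : ℝ) (φ : TestFn T) (x t : ℝ) :
    φ.wave c x t = deriv (fun s => φ.dt x s) t - c ^ 2 * deriv (fun y => φ.dx y t) x := by
  simp only [wave, iteratedDeriv_succ, iteratedDeriv_zero]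
  rfl

theorem continuous_wave (c : ℝ) (φ : TestFn T) :
    Continuous (fun z : ℝ × ℝ => φ.wave c z.1 z.2) := by
  simp only [wave_eq]
  exact (contDiff_deriv_snd φ.contDiff_dt).continuous.sub
    (continuous_const.mul (contDiff_deriv_fst φ.contDiff_dx).continuous)

theorem continuous_dx (φ : TestFn T) (x : ℝ) : Continuous (φ.dx x) :=
  φ.contDiff_dx.continuous.comp (continuous_const.prodMk continuous_id)

theorem continuous_dt_left (φ : TestFn T) (t : ℝ) : Continuous (fun x => φ.dt x t) :=
  φ.contDiff_dt.continuous.comp (continuous_id.prodMk continuous_const)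

theorem continuous_left (φ : TestFn T) (t : ℝ) : Continuous (fun x => φ.toFun x t) :=
  φ.smooth.continuous.comp (continuous_id.prodMk continuous_const)

/-- The test function `X(x) ψ(t)`. -/
def tensor (X : ℝ → ℝ) (hX : ContDiff ℝ ∞ X) (ψ : timeTest T) : TestFn T where
  toFun x t := X x * (ψ : ℝ → ℝ) t
  smooth := (hX.comp contDiff_fst).mul (ψ.2.1.comp contDiff_snd)
  vanish := by
    obtain ⟨T', hT', h⟩ := ψ.2.2
    exact ⟨T', hT', fun x t ht => by simp [h t ht]⟩

/-- A smooth function that vanishes near and after the final time for `x` in a neighbourhood of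
`[r - L, r + L]` agrees there with a test function. -/
theorem exists_eq_near {Φ : ℝ → ℝ → ℝ} (hΦ : ContDiff ℝ ∞ (fun z : ℝ × ℝ => Φ z.1 z.2))
    {r L ε T' : ℝ} (hL : 0 < L) (hε : 0 < ε) (hT' : T' < T)
    (h0 : ∀ x t, |x - r| < L + ε → T' ≤ t → Φ x t = 0) :
    ∃ φ : TestFn T, ∀ x, |x - r| < L + ε / 2 → ∀ t, φ.toFun x t = Φ x t := by
  -- The cutoff is needed because `TestFn` demands vanishing in time for all x at once. Agreement on
  -- an open set larger than [r - L, r + L] makes the x-derivatives agree up to the end points.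
  let χ : ContDiffBump r := ⟨L + ε / 2, L + ε, by linarith, by linarith⟩
  refine ⟨⟨fun x t => χ x * Φ x t, (χ.contDiff.comp contDiff_fst).mul hΦ, T', hT', ?_⟩, ?_⟩
  · intro x t ht
    by_cases hx : |x - r| < L + ε
    · simp [h0 x t hx ht]
    · have : χ x = 0 := χ.zero_of_le_dist (by rw [Real.dist_eq]; exact not_lt.1 hx)
      simp [this]
  · intro x hx t
    have : χ x = 1 := χ.one_of_mem_closedBall (by
      rw [Metric.mem_closedBall, Real.dist_eq]; exact hx.le)
    simp [this]

end TestFn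

/-- Integrating from a time T' after which ψ is zero keeps the primitive zero from T' on, so it is
again a test function. -/
theorem timeTest.exists_primitive {T : ℝ} (ψ : timeTest T) :
    ∃ Θ : timeTest T, ∀ t, HasDerivAt (Θ : ℝ → ℝ) ((ψ : ℝ → ℝ) t) t := by
  obtain ⟨ψ, hψ, T', hT', h0⟩ := ψ
  have hd : ∀ t, HasDerivAt (fun s => ∫ x in T'..s, ψ x) (ψ t) t := fun t =>
    intervalIntegral.integral_hasDerivAt_right (hψ.continuous.intervalIntegrable _ _)
      hψ.continuous.stronglyMeasurable.stronglyMeasurableAtFilter hψ.continuous.continuousAt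
  refine ⟨⟨fun t => ∫ s in T'..t, ψ s, ?_, T', hT', ?_⟩, hd⟩
  · rw [contDiff_infty_iff_deriv]
    refine ⟨fun t => (hd t).differentiableAt, ?_⟩
    rwa [funext fun t => (hd t).deriv]
  · intro t ht
    change ∫ s in T'..t, ψ s = 0
    rw [intervalIntegral.integral_congr (g := fun _ => (0 : ℝ))]
    · simp
    · intro s hs
      rw [uIcc_of_le ht] at hs
      exact h0 s hs.1

/-- Variation of constants, with both coefficient integrals taken backward from the final time so
that y inherits the vanishing there. No condition at t = 0 has to be met. -/
theorem timeTest.exists_oscillator {T κ : ℝ} (hκ : κ ≠ 0) (ψ : timeTest T) :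
    ∃ y : timeTest T, ∀ t,
      deriv (deriv (y : ℝ → ℝ)) t + κ ^ 2 * (y : ℝ → ℝ) t = (ψ : ℝ → ℝ) t := by
  have hsin : ContDiff ℝ ∞ (fun t => Real.sin (κ * t)) :=
    Real.contDiff_sin.comp (contDiff_const.mul contDiff_id)
  have hcos : ContDiff ℝ ∞ (fun t => Real.cos (κ * t)) :=
    Real.contDiff_cos.comp (contDiff_const.mul contDiff_id)
  obtain ⟨T', hT', h0⟩ := ψ.2.2
  obtain ⟨A, hA⟩ := timeTest.exists_primitive (T := T)
    ⟨fun t => Real.sin (κ * t) * (ψ : ℝ → ℝ) t, hsin.mul ψ.2.1, T', hT',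
      fun t ht => by simp [h0 t ht]⟩
  obtain ⟨B, hB⟩ := timeTest.exists_primitive (T := T)
    ⟨fun t => Real.cos (κ * t) * (ψ : ℝ → ℝ) t, hcos.mul ψ.2.1, T', hT',
      fun t ht => by simp [h0 t ht]⟩
  obtain ⟨TA, hTA, hA0⟩ := A.2.2
  obtain ⟨TB, hTB, hB0⟩ := B.2.2
  have dsin : ∀ t, HasDerivAt (fun t => Real.sin (κ * t)) (Real.cos (κ * t) * κ) t := fun t => by
    simpa using ((hasDerivAt_id t).const_mul κ).sin
  have dcos : ∀ t, HasDerivAt (fun t => Real.cos (κ * t)) (-Real.sin (κ * t) * κ) t := fun t => by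
    simpa using ((hasDerivAt_id t).const_mul κ).cos
  let y : timeTest T := ⟨fun t => κ⁻¹ * (Real.sin (κ * t) * (B : ℝ → ℝ) t
      - Real.cos (κ * t) * (A : ℝ → ℝ) t),
    contDiff_const.mul ((hsin.mul B.2.1).sub (hcos.mul A.2.1)), max TA TB, max_lt hTA hTB,
    fun t ht => by
      simp [hA0 t ((le_max_left _ _).trans ht), hB0 t ((le_max_right _ _).trans ht)]⟩
  have h1 : deriv (y : ℝ → ℝ) = fun t =>
      Real.cos (κ * t) * (B : ℝ → ℝ) t + Real.sin (κ * t) * (A : ℝ → ℝ) t := by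
    funext t
    refine (((dsin t).mul (hB t)).sub ((dcos t).mul (hA t))).const_mul κ⁻¹ |>.deriv.trans ?_
    field_simp
    ring
  refine ⟨y, fun t => ?_⟩
  have h2 := (((dcos t).mul (hB t)).add ((dsin t).mul (hA t))).deriv
  rw [h1]
  refine (congrArg (· + _) h2).trans ?_
  have := Real.sin_sq_add_cos_sq (κ * t)
  change _ + κ ^ 2 * (κ⁻¹ * (Real.sin (κ * t) * (B : ℝ → ℝ) t
      - Real.cos (κ * t) * (A : ℝ → ℝ) t)) = _
  field_simp
  linear_combination ((ψ : ℝ → ℝ) t) * this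

/-! ### Functions that are orthogonal to test functions -/

/-- The fundamental lemma of the calculus of variations on (0, s). Stopping at s < T permits test
functions that vanish before s, which is what localizes the interface relation in time. -/
theorem ae_eq_zero_of_integral_mul_timeTest {T s : ℝ} {g : ℝ → ℝ}
    (hg : IntegrableOn g (Ioo 0 T)) (hs : s ≤ T)
    (h : ∀ η : timeTest T, (∃ s' < s, ∀ t, s' ≤ t → (η : ℝ → ℝ) t = 0) →
      ∫ t in Ioo 0 T, g t * (η : ℝ → ℝ) t = 0) :
    ∀ᵐ t ∂(volume.restrict (Ioo 0 T)), t < s → g t = 0 := by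
  rw [ae_restrict_iff' measurableSet_Ioo]
  have hsub : Ioo 0 s ⊆ Ioo 0 T := Ioo_subset_Ioo_right hs
  have := isOpen_Ioo.ae_eq_zero_of_integral_contDiff_smul_eq_zero (f := g) (μ := volume)
    (U := Ioo 0 s) (hg.mono_set hsub).locallyIntegrableOn ?_
  · filter_upwards [this] with t ht ht0 hts using ht ⟨ht0.1, hts⟩
  intro η hη hc hsupp
  have hη0 : ∃ s' < s, ∀ t, s' ≤ t → η t = 0 := by
    by_cases hne : (tsupport η).Nonempty
    -- The compact support has a last point m < s, and any time strictly between m and s serves as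
    -- s'.
    · obtain ⟨m, hm, hmax⟩ := hc.isCompact.exists_isMaxOn hne continuousOn_id
      refine ⟨(m + s) / 2, by linarith [(hsupp hm).2], fun t ht => ?_⟩
      by_contra hne
      have h1 : t ≤ m := hmax (subset_tsupport _ hne)
      linarith [(hsupp hm).2]
    · refine ⟨s - 1, by linarith, fun t _ => ?_⟩
      by_contra hne'
      exact hne ⟨t, subset_tsupport _ hne'⟩
  obtain ⟨s', hs', h0⟩ := hη0
  have key := h ⟨η, hη, s', by linarith, h0⟩ ⟨s', hs', h0⟩
  rw [← setIntegral_eq_integral_of_forall_compl_eq_zero (s := Ioo 0 T)]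
  · refine Eq.trans ?_ key
    exact integral_congr_ae (Eventually.of_forall fun t => mul_comm _ _)
  · intro t ht
    have : η t = 0 := by
      by_contra hne
      exact ht (hsub (hsupp (subset_tsupport _ hne)))
    simp [this]

/-- Induction on the power by sin(nθ) cos θ = (sin((n+1)θ) + sin((n-1)θ))/2. Integer frequencies
keep n - 1 admissible. -/
theorem integral_sin_mul_cos_pow_eq_zero {g θ : ℝ → ℝ} {p q : ℝ} (hθ : Continuous θ)
    (hg : IntegrableOn g (Ioo p q))
    (h : ∀ n : ℤ, ∫ x in Ioo p q, g x * Real.sin (n * θ x) = 0) (m : ℕ) :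
    ∀ n : ℤ, ∫ x in Ioo p q, g x * (Real.sin (n * θ x) * Real.cos (θ x) ^ m) = 0 := by
  have hi : ∀ (m : ℕ) (n : ℤ),
      IntegrableOn (fun x => g x * (Real.sin (n * θ x) * Real.cos (θ x) ^ m)) (Ioo p q) :=
    fun m n => integrableOn_mul_continuous hg (by fun_prop)
  induction m with
  | zero => simpa using h
  | succ m ih =>
    intro n
    have : ∀ x, g x * (Real.sin (n * θ x) * Real.cos (θ x) ^ (m + 1)) =
        (1 / 2) * (g x * (Real.sin ((n + 1 : ℤ) * θ x) * Real.cos (θ x) ^ m)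
          + g x * (Real.sin ((n - 1 : ℤ) * θ x) * Real.cos (θ x) ^ m)) := by
      intro x
      push_cast
      rw [add_mul, sub_mul, one_mul, Real.sin_add, Real.sin_sub]
      ring
    simp only [this]
    rw [integral_const_mul, integral_add (hi m _) (hi m _), ih, ih]
    simp

/-- The functions `sin (n π (x - p) / (q - p))` are complete in `L¹(p,q)`. -/
theorem ae_eq_zero_of_integral_mul_sin {g : ℝ → ℝ} {p q : ℝ} (hpq : p < q)
    (hg : IntegrableOn g (Ioo p q))
    (h : ∀ n : ℤ, ∫ x in Ioo p q, g x * Real.sin (n * (Real.pi / (q - p) * (x - p))) = 0) :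
    ∀ᵐ x ∂(volume.restrict (Ioo p q)), g x = 0 := by
  set θ : ℝ → ℝ := fun x => Real.pi / (q - p) * (x - p) with hθdef
  have hL : 0 < q - p := by linarith
  have hpi := Real.pi_pos
  have hθ : Continuous θ := by fun_prop
  have hθmem : ∀ x ∈ Ioo p q, θ x ∈ Ioo 0 Real.pi := by
    intro x hx
    have h1 : 0 < x - p := by linarith [hx.1]
    refine ⟨by positivity, ?_⟩
    change Real.pi / (q - p) * (x - p) < _
    rw [div_mul_eq_mul_div, div_lt_iff₀ hL]
    exact mul_lt_mul_of_pos_left (by linarith [hx.2]) hpi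
  have hv : IntegrableOn (fun x => g x * Real.sin (θ x)) (Ioo p q) :=
    integrableOn_mul_continuous hg (by fun_prop)
  -- Orthogonality to all sines thus makes g sin θ orthogonal to every polynomial in cos θ. As cos θ
  -- is injective on (p, q), Weierstrass approximation extends this to test functions, and sin θ > 0
  -- can then be divided out.
  have hpoly : ∀ P : Polynomial ℝ,
      ∫ x in Ioo p q, g x * Real.sin (θ x) * P.eval (Real.cos (θ x)) = 0 := by
    intro P
    have hmono := fun m => integral_sin_mul_cos_pow_eq_zero hθ hg h m 1
    simp only [Polynomial.eval_eq_sum_range, Finset.mul_sum]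
    rw [integral_finsetSum]
    · refine Finset.sum_eq_zero fun m _ => ?_
      rw [← mul_zero (P.coeff m), ← hmono m, ← integral_const_mul]
      refine integral_congr_ae (Eventually.of_forall fun x => ?_)
      simp only [Int.cast_one, one_mul]
      ring
    · intro m _
      exact integrableOn_mul_continuous hv (by fun_prop)
  have hzero := isOpen_Ioo.ae_eq_zero_of_integral_contDiff_smul_eq_zero
    (f := fun x => g x * Real.sin (θ x)) (μ := volume) (U := Ioo p q) hv.locallyIntegrableOn ?_
  · rw [ae_restrict_iff' measurableSet_Ioo]
    filter_upwards [hzero] with x hx hxm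
    have := Real.sin_pos_of_pos_of_lt_pi (hθmem x hxm).1 (hθmem x hxm).2
    exact (mul_eq_zero.1 (hx hxm)).resolve_right this.ne'
  intro G hG _ hsupp
  set v : ℝ → ℝ := fun x => g x * Real.sin (θ x) with hvdef
  rw [← setIntegral_eq_integral_of_forall_compl_eq_zero (s := Ioo p q)]
  swap
  · intro x hx
    have : G x = 0 := by
      by_contra hne
      exact hx (hsupp (subset_tsupport _ hne))
    simp [this]
  -- K is G in the variable y = cos θ(x), continuous on [-1, 1] and hence uniformly approximable by
  -- polynomials.
  let K : ℝ → ℝ := fun y => G (p + (q - p) / Real.pi * Real.arccos y)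
  have hK : Continuous K :=
    hG.continuous.comp (continuous_const.add (continuous_const.mul Real.continuous_arccos))
  have hKG : ∀ x ∈ Ioo p q, K (Real.cos (θ x)) = G x := by
    intro x hx
    change G (p + (q - p) / Real.pi * Real.arccos (Real.cos (θ x))) = G x
    rw [Real.arccos_cos (hθmem x hx).1.le (hθmem x hx).2.le]
    congr 1
    change p + (q - p) / Real.pi * (Real.pi / (q - p) * (x - p)) = x
    field_simp
    ring
  have hbound : ∀ ε > 0, |∫ x in Ioo p q, G x • v x| ≤ ε * ∫ x in Ioo p q, |v x| := by
    intro ε hε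
    obtain ⟨P, hP⟩ := exists_polynomial_near_of_continuousOn (-1) 1 K hK.continuousOn ε hε
    have hPc : Continuous fun x => P.eval (Real.cos (θ x)) := by fun_prop
    have e1 : ∫ x in Ioo p q, G x • v x =
        ∫ x in Ioo p q, (v x * G x - v x * P.eval (Real.cos (θ x))) := by
      rw [integral_sub (integrableOn_mul_continuous hv hG.continuous)
        (integrableOn_mul_continuous hv hPc), hpoly P, sub_zero]
      exact integral_congr_ae (Eventually.of_forall fun x => by simp [mul_comm])
    rw [e1, ← integral_const_mul]
    refine abs_integral_le_integral_abs.trans (setIntegral_mono_on ?_ ?_ measurableSet_Ioo ?_)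
    · exact ((integrableOn_mul_continuous hv hG.continuous).sub
        (integrableOn_mul_continuous hv hPc)).abs
    · exact hv.abs.const_mul ε
    · intro x hx
      rw [← mul_sub, abs_mul, mul_comm]
      refine mul_le_mul_of_nonneg_right ?_ (abs_nonneg _)
      rw [← hKG x hx, abs_sub_comm]
      exact (hP _ ⟨Real.neg_one_le_cos _, Real.cos_le_one _⟩).le
  by_contra hne
  have hpos : 0 < |∫ x in Ioo p q, G x • v x| := abs_pos.2 hne
  have hI : 0 ≤ ∫ x in Ioo p q, |v x| := integral_nonneg fun _ => abs_nonneg _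
  have := hbound (|∫ x in Ioo p q, G x • v x| / (2 * ((∫ x in Ioo p q, |v x|) + 1)))
    (by positivity)
  rw [div_mul_eq_mul_div, le_div_iff₀ (by positivity)] at this
  nlinarith

/-- The standing wave `F(t + (x - r) / c) - F(t - (x - r) / c)`, which vanishes at `x = r`, as a
test function on `[r - L, r + L]`. -/
theorem TestFn.exists_odd_wave {T c r L S : ℝ} (hc : 0 < c) (hL : 0 < L) {F : ℝ → ℝ}
    (hF : ContDiff ℝ ∞ F) (hS : S < T - L / c) (h0 : ∀ s, S ≤ s → F s = 0) :
    ∃ φ : TestFn T, ∀ x, |x - r| ≤ L → ∀ t,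
      φ.toFun x t = F (t + (x - r) / c) - F (t - (x - r) / c) ∧
      φ.dx x t = 1 / c * (deriv F (t + (x - r) / c) + deriv F (t - (x - r) / c)) ∧
      φ.wave c x t = 0 := by
  -- Half of the slack before T. Widening the space interval by cδ costs travel time δ, and S + L/c
  -- + δ is still below T.
  set δ := (T - L / c - S) / 2 with hδ
  have hδ0 : 0 < δ := by rw [hδ]; linarith
  have hF1 : ∀ s, HasDerivAt F (deriv F s) s := fun s =>
    (hF.differentiable (by simp) s).hasDerivAt
  have hF' : ContDiff ℝ ∞ (deriv F) := (contDiff_infty_iff_deriv.1 hF).2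
  have hF2 : ∀ s, HasDerivAt (deriv F) (deriv (deriv F) s) s := fun s =>
    (hF'.differentiable (by simp) s).hasDerivAt
  obtain ⟨φ, hφ⟩ := TestFn.exists_eq_near (T := T) (r := r) (L := L) (ε := c * δ)
    (T' := S + L / c + δ) (Φ := fun x t => F (t + (x - r) / c) - F (t - (x - r) / c))
    (by fun_prop) hL (by positivity) (by rw [hδ]; linarith) (by
      intro x t hx ht
      have h1 : |(x - r) / c| < L / c + δ := by
        rw [abs_div, abs_of_pos hc, div_lt_iff₀ hc, add_mul, div_mul_cancel₀ _ hc.ne']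
        linarith
      have h2 := abs_lt.1 h1
      rw [h0 _ (by linarith [h2.1]), h0 _ (by linarith [h2.2]), sub_zero])
  have hlin : ∀ x, HasDerivAt (fun y => (y - r) / c) (1 / c) x := fun x =>
    ((hasDerivAt_id x).sub_const r).div_const c
  have hnear : ∀ x, |x - r| < L + c * δ / 2 → ∀ᶠ y in nhds x, |y - r| < L + c * δ / 2 :=
    fun x hx => (isOpen_lt (by fun_prop) continuous_const).mem_nhds hx
  have hdx : ∀ x, |x - r| < L + c * δ / 2 → ∀ t, φ.dx x t =
      1 / c * (deriv F (t + (x - r) / c) + deriv F (t - (x - r) / c)) := by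
    intro x hx t
    have e : (fun y => φ.toFun y t) =ᶠ[nhds x]
        fun y => F (t + (y - r) / c) - F (t - (y - r) / c) :=
      (hnear x hx).mono fun y hy => hφ y hy t
    rw [TestFn.dx, e.deriv_eq]
    refine ((HasDerivAt.comp x (hF1 _) ((hlin x).const_add t)).sub
      (HasDerivAt.comp x (hF1 _) ((hlin x).const_sub t))).deriv.trans ?_
    ring
  refine ⟨φ, fun x hxL t => ?_⟩
  have hx : |x - r| < L + c * δ / 2 := by
    have : 0 < c * δ / 2 := by positivity
    linarith
  refine ⟨hφ x hx t, hdx x hx t, ?_⟩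
  rw [TestFn.wave_eq]
  have hdt : (fun s => φ.dt x s) =
      fun s => deriv F (s + (x - r) / c) - deriv F (s - (x - r) / c) := by
    funext s
    rw [TestFn.dt, funext (hφ x hx)]
    exact (((hF1 _).comp_add_const s _).sub ((hF1 _).comp_sub_const s _)).deriv
  have e : (fun y => φ.dx y t) =ᶠ[nhds x]
      fun y => 1 / c * (deriv F (t + (y - r) / c) + deriv F (t - (y - r) / c)) :=
    (hnear x hx).mono fun y hy => hdx y hy t
  have e1 := (((hF2 _).comp_add_const t ((x - r) / c)).sub
    ((hF2 _).comp_sub_const t ((x - r) / c))).deriv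
  have e2 := (((HasDerivAt.comp x (hF2 _) ((hlin x).const_add t)).add
      (HasDerivAt.comp x (hF2 _) ((hlin x).const_sub t))).const_mul (1 / c)).deriv
  rw [hdt, e.deriv_eq]
  refine (congrArg₂ (fun y z => y - c ^ 2 * z) e1 e2).trans ?_
  field_simp
  ring

/-! ### Solutions of the wave equation -/

namespace IsWaveSolution

variable {c T p q r : ℝ} {f u u' : ℝ → ℝ → ℝ} {u₀ v₀ αp αq αp' αq' α : ℝ → ℝ}
  {νp νq νp' νq' ν : Flux T}

/-- Source and initial data cancel in the difference, leaving only boundary terms. -/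
theorem green_sub (h : IsWaveSolution c T p q f u₀ v₀ αp αq νp νq u)
    (h' : IsWaveSolution c T p q f u₀ v₀ αp' αq' νp' νq' u') (φ : TestFn T) :
    ∫ z in Ioo p q ×ˢ Ioo 0 T, (u z.1 z.2 - u' z.1 z.2) * φ.wave c z.1 z.2 =
      c ^ 2 * ((νp - νp') (φ.slice p) + ∫ t in Ioo 0 T, (αp t - αp' t) * φ.dx p t)
      + c ^ 2 * ((νq - νq') (φ.slice q) - ∫ t in Ioo 0 T, (αq t - αq' t) * φ.dx q t) := by
  simp only [sub_mul]
  rw [integral_sub (integrableOn_mul_continuous_prod h.integrable_sol (φ.continuous_wave c))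
      (integrableOn_mul_continuous_prod h'.integrable_sol (φ.continuous_wave c)),
    integral_sub (integrableOn_mul_continuous h.integrable_left (φ.continuous_dx p))
      (integrableOn_mul_continuous h'.integrable_left (φ.continuous_dx p)),
    integral_sub (integrableOn_mul_continuous h.integrable_right (φ.continuous_dx q))
      (integrableOn_mul_continuous h'.integrable_right (φ.continuous_dx q)),
    h.green, h'.green]
  simp only [LinearMap.sub_apply]
  ring

theorem congr (h : IsWaveSolution c T p q f u₀ v₀ αp αq νp νq u)
    (hu : ∀ᵐ z ∂((volume : Measure (ℝ × ℝ)).restrict (Ioo p q ×ˢ Ioo 0 T)),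
      u z.1 z.2 = u' z.1 z.2)
    (hp : ∀ᵐ t ∂(volume.restrict (Ioo 0 T)), αp t = αp' t)
    (hq : ∀ᵐ t ∂(volume.restrict (Ioo 0 T)), αq t = αq' t) :
    IsWaveSolution c T p q f u₀ v₀ αp' αq' νp νq u' where
  integrable_sol := h.integrable_sol.congr hu
  integrable_source := h.integrable_source
  integrable_pos := h.integrable_pos
  integrable_vel := h.integrable_vel
  integrable_left := h.integrable_left.congr hp
  integrable_right := h.integrable_right.congr hq
  green φ := by
    have e1 : ∫ z in Ioo p q ×ˢ Ioo 0 T, u' z.1 z.2 * φ.wave c z.1 z.2 =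
        ∫ z in Ioo p q ×ˢ Ioo 0 T, u z.1 z.2 * φ.wave c z.1 z.2 :=
      integral_congr_ae (hu.mono fun z hz => by simp only [hz])
    have e2 : ∫ t in Ioo 0 T, αp' t * φ.dx p t = ∫ t in Ioo 0 T, αp t * φ.dx p t :=
      integral_congr_ae (hp.mono fun t ht => by simp only [ht])
    have e3 : ∫ t in Ioo 0 T, αq' t * φ.dx q t = ∫ t in Ioo 0 T, αq t * φ.dx q t :=
      integral_congr_ae (hq.mono fun t ht => by simp only [ht])
    rw [e1, e2, e3, h.green]

theorem right_value_unique (hpq : p < q) (hc : 0 < c)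
    (h : IsWaveSolution c T p q f u₀ v₀ αp αq νp νq u)
    (h' : IsWaveSolution c T p q f u₀ v₀ αp αq' νp' νq' u) :
    ∀ᵐ t ∂(volume.restrict (Ioo 0 T)), αq t - αq' t = 0 := by
  have key := ae_eq_zero_of_integral_mul_timeTest (g := fun t => αq t - αq' t)
    (h.integrable_right.sub h'.integrable_right) le_rfl ?_
  · filter_upwards [key, ae_restrict_mem measurableSet_Ioo] with t ht htm using ht htm.2
  intro η _
  -- This profile vanishes at both ends, which removes the unknown fluxes, but has slope q - p ≠ 0
  -- at q, which isolates the trace there.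
  have hX : ContDiff ℝ ∞ (fun x : ℝ => (x - p) * (x - q)) := by fun_prop
  have hdX : HasDerivAt (fun x : ℝ => (x - p) * (x - q)) (q - p) q := by
    refine (((hasDerivAt_id q).sub_const p).mul ((hasDerivAt_id q).sub_const q)).congr_deriv ?_
    simp
  let φ : TestFn T := TestFn.tensor _ hX η
  have hp0 : φ.slice p = 0 := by
    ext t
    change (p - p) * (p - q) * (η : ℝ → ℝ) t = 0
    ring
  have hq0 : φ.slice q = 0 := by
    ext t
    change (q - p) * (q - q) * (η : ℝ → ℝ) t = 0
    ring
  have hdx : ∀ t, φ.dx q t = (q - p) * (η : ℝ → ℝ) t := fun t => (hdX.mul_const _).deriv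
  have := h.green_sub h' φ
  simp only [sub_self, zero_mul, integral_zero, hp0, hq0, map_zero, hdx, add_zero, mul_zero,
    zero_add, zero_sub, mul_left_comm _ (q - p), integral_const_mul] at this
  have h1 : q - p ≠ 0 := by linarith
  simpa [hc.ne', h1] using this

/-- Each sine coefficient in x of the difference is orthogonal to all time test functions, hence
zero for almost every t. Completeness of the sines on almost every time slice then concludes. -/
theorem unique (hpq : p < q) (hc : 0 < c)
    (h : IsWaveSolution c T p q f u₀ v₀ αp αq νp νq u)
    (h' : IsWaveSolution c T p q f u₀ v₀ αp αq νp' νq' u') :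
    ∀ᵐ z ∂((volume : Measure (ℝ × ℝ)).restrict (Ioo p q ×ˢ Ioo 0 T)),
      u z.1 z.2 = u' z.1 z.2 := by
  have hL : 0 < q - p := by linarith
  have hpi := Real.pi_pos
  let e : ℝ × ℝ → ℝ := fun z => u z.1 z.2 - u' z.1 z.2
  have he : IntegrableOn e (Ioo p q ×ˢ Ioo 0 T) := h.integrable_sol.sub h'.integrable_sol
  have hprod : (volume : Measure (ℝ × ℝ)).restrict (Ioo p q ×ˢ Ioo 0 T) =
      (volume.restrict (Ioo p q)).prod (volume.restrict (Ioo 0 T)) := by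
    rw [Measure.volume_eq_prod, Measure.prod_restrict]
  have hsinc : ∀ n : ℤ, Continuous fun z : ℝ × ℝ =>
      Real.sin (n * (Real.pi / (q - p) * (z.1 - p))) := fun n => by fun_prop
  have hcoef : ∀ n : ℤ, ∀ᵐ t ∂(volume.restrict (Ioo 0 T)),
      ∫ x in Ioo p q, e (x, t) * Real.sin (n * (Real.pi / (q - p) * (x - p))) = 0 := by
    intro n
    by_cases hn : n = 0
    · simp [hn]
    have hi := integrableOn_mul_continuous_prod he (hsinc n)
    rw [IntegrableOn, hprod] at hi
    have key := ae_eq_zero_of_integral_mul_timeTest (T := T)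
      (g := fun t => ∫ x in Ioo p q, e (x, t) * Real.sin (n * (Real.pi / (q - p) * (x - p))))
      hi.integral_prod_right le_rfl ?_
    · filter_upwards [key, ae_restrict_mem measurableSet_Ioo] with t ht htm using ht htm.2
    intro η _
    set κ : ℝ := n * (Real.pi / (q - p)) with hκ
    have hκ0 : κ ≠ 0 := mul_ne_zero (Int.cast_ne_zero.2 hn) (by positivity)
    -- With y'' + (cκ)² y = η, the wave operator maps sin(κ(x - p)) y(t) to sin(κ(x - p)) η(t). The
    -- sine is zero at p and q, so no flux enters.
    obtain ⟨y, hy⟩ := timeTest.exists_oscillator (mul_ne_zero hc.ne' hκ0) η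
    have hX : ContDiff ℝ ∞ (fun x : ℝ => Real.sin (κ * (x - p))) := by fun_prop
    let φ : TestFn T := TestFn.tensor _ hX y
    have hlin : ∀ x, HasDerivAt (fun x => κ * (x - p)) κ x := fun x => by
      simpa using ((hasDerivAt_id x).sub_const p).const_mul κ
    have hdx : ∀ x t, φ.dx x t = Real.cos (κ * (x - p)) * κ * (y : ℝ → ℝ) t := fun x t =>
      ((hlin x).sin.mul_const _).deriv
    have hdt : ∀ x t, φ.dt x t = Real.sin (κ * (x - p)) * deriv (y : ℝ → ℝ) t := fun x t =>
      (((y.2.1.differentiable (by simp) t).hasDerivAt).const_mul _).deriv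
    have hwave : ∀ x t, φ.wave c x t = Real.sin (κ * (x - p)) * (η : ℝ → ℝ) t := by
      intro x t
      have hy' : ContDiff ℝ ∞ (deriv (y : ℝ → ℝ)) := (contDiff_infty_iff_deriv.1 y.2.1).2
      rw [TestFn.wave_eq]
      simp only [hdx, hdt]
      rw [(((hy'.differentiable (by simp) t).hasDerivAt).const_mul _).deriv,
        (((hlin x).cos.mul_const κ).mul_const _).deriv, ← hy]
      ring
    have hp0 : φ.slice p = 0 := by
      ext t
      change Real.sin (κ * (p - p)) * (y : ℝ → ℝ) t = 0
      simp
    have hq0 : φ.slice q = 0 := by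
      ext t
      change Real.sin (κ * (q - p)) * (y : ℝ → ℝ) t = 0
      rw [hκ, mul_assoc, div_mul_cancel₀ _ hL.ne', Real.sin_int_mul_pi, zero_mul]
    have hg := h.green_sub h' φ
    simp only [sub_self, zero_mul, integral_zero, hp0, hq0, map_zero, add_zero, mul_zero,
      hwave] at hg
    have hi2 : IntegrableOn (fun z : ℝ × ℝ =>
        e z * (Real.sin (κ * (z.1 - p)) * (η : ℝ → ℝ) z.2)) (Ioo p q ×ˢ Ioo 0 T) :=
      integrableOn_mul_continuous_prod he
        (Continuous.mul (by fun_prop) (η.2.1.continuous.comp continuous_snd))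
    rw [IntegrableOn, hprod] at hi2
    rw [hprod] at hg
    refine Eq.trans ?_ ((integral_prod_symm _ hi2).symm.trans hg)
    refine integral_congr_ae (Eventually.of_forall fun t => ?_)
    simp only [← integral_mul_const]
    refine integral_congr_ae (Eventually.of_forall fun x => ?_)
    simp only [hκ]
    ring_nf
  rw [IntegrableOn, hprod] at he
  have hsec : ∀ᵐ t ∂(volume.restrict (Ioo 0 T)),
      ∫ x in Ioo p q, ‖e (x, t)‖ = 0 := by
    filter_upwards [ae_all_iff.2 hcoef, he.prod_left_ae] with t ht hit
    have := ae_eq_zero_of_integral_mul_sin hpq hit ht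
    rw [integral_congr_ae (g := fun _ => (0 : ℝ))
      (this.mono fun x hx => by simp only [hx, norm_zero]), integral_zero]
  have h0 : ∫ z, ‖e z‖ ∂((volume.restrict (Ioo p q)).prod (volume.restrict (Ioo 0 T))) = 0 := by
    rw [integral_prod_symm _ he.norm, integral_congr_ae hsec, integral_zero]
  rw [integral_eq_zero_iff_of_nonneg (fun _ => norm_nonneg _) he.norm] at h0
  rw [hprod]
  filter_upwards [h0] with z hz
  exact sub_eq_zero.1 (norm_eq_zero.1 hz)

/-- The outward normals at r are opposite, so the flux terms ν and -ν cancel, as do the trace terms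
with the common value α. -/
theorem glue (hpr : p < r) (hrq : r < q)
    (h : IsWaveSolution c T p r f u₀ v₀ αp α νp ν u)
    (h' : IsWaveSolution c T r q f u₀ v₀ α αq (-ν) νq u) :
    IsWaveSolution c T p q f u₀ v₀ αp αq νp νq u := by
  have hae : (Ioo p q : Set ℝ) =ᵐ[volume] (Ioo p r ∪ Ioo r q : Set ℝ) := by
    have h1 : (Ioo p q : Set ℝ) = Ioc p r ∪ Ioo r q := (Ioc_union_Ioo_eq_Ioo hpr.le hrq).symm
    rw [h1]
    exact ae_eq_set_union Ioo_ae_eq_Ioc.symm (ae_eq_refl _)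
  have hdisj : Disjoint (Ioo p r) (Ioo r q) :=
    disjoint_left.2 fun x hx hx' => lt_asymm hx.2 hx'.1
  have haep : (Ioo p q ×ˢ Ioo 0 T : Set (ℝ × ℝ)) =ᵐ[volume]
      (Ioo p r ×ˢ Ioo 0 T ∪ Ioo r q ×ˢ Ioo 0 T : Set (ℝ × ℝ)) := by
    rw [← union_prod, Measure.volume_eq_prod]
    exact Measure.set_prod_ae_eq hae (ae_eq_refl _)
  have hdisjp : Disjoint (Ioo p r ×ˢ Ioo 0 T) (Ioo r q ×ˢ Ioo (0 : ℝ) T) :=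
    disjoint_prod.2 (Or.inl hdisj)
  have hm : MeasurableSet (Ioo r q ×ˢ Ioo (0 : ℝ) T) := measurableSet_Ioo.prod measurableSet_Ioo
  have split1 : ∀ g : ℝ → ℝ, IntegrableOn g (Ioo p q) →
      ∫ x in Ioo p q, g x = (∫ x in Ioo p r, g x) + ∫ x in Ioo r q, g x := by
    intro g hg
    rw [setIntegral_congr_set hae, setIntegral_union hdisj measurableSet_Ioo
      (hg.mono_set (Ioo_subset_Ioo_right hrq.le)) (hg.mono_set (Ioo_subset_Ioo_left hpr.le))]
  have split2 : ∀ g : ℝ × ℝ → ℝ, IntegrableOn g (Ioo p r ×ˢ Ioo 0 T) →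
      IntegrableOn g (Ioo r q ×ˢ Ioo 0 T) →
      ∫ z in Ioo p q ×ˢ Ioo 0 T, g z =
        (∫ z in Ioo p r ×ˢ Ioo 0 T, g z) + ∫ z in Ioo r q ×ˢ Ioo 0 T, g z := by
    intro g hg hg'
    rw [setIntegral_congr_set haep, setIntegral_union hdisjp hm hg hg']
  have hu₀ := (integrableOn_congr_set_ae hae).2 (h.integrable_pos.union h'.integrable_pos)
  have hv₀ := (integrableOn_congr_set_ae hae).2 (h.integrable_vel.union h'.integrable_vel)
  refine ⟨(integrableOn_congr_set_ae haep).2 (h.integrable_sol.union h'.integrable_sol),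
    (integrableOn_congr_set_ae haep).2 (h.integrable_source.union h'.integrable_source), hu₀, hv₀,
    h.integrable_left, h'.integrable_right, fun φ => ?_⟩
  have hw := φ.continuous_wave c
  have hs := φ.smooth.continuous
  rw [split2 _ (integrableOn_mul_continuous_prod h.integrable_sol hw)
      (integrableOn_mul_continuous_prod h'.integrable_sol hw),
    split2 _ (integrableOn_mul_continuous_prod h.integrable_source hs)
      (integrableOn_mul_continuous_prod h'.integrable_source hs),
    split1 _ (integrableOn_mul_continuous hv₀ (φ.continuous_left 0)),
    split1 _ (integrableOn_mul_continuous hu₀ (φ.continuous_dt_left 0)), h.green, h'.green]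
  simp only [LinearMap.neg_apply]
  ring

end IsWaveSolution

/-! ### The interface iteration -/

/-- The relation between the changes of the Dirichlet data on the two sides of the interface when
the normal derivatives on both sides change by the same amount. -/
theorem interface_relation {a b c T : ℝ} (ha : 0 < a) (hb : 0 < b) (hc : 0 < c)
    {f u₁ u₁' u₂ u₂' : ℝ → ℝ → ℝ} {u₀ v₀ gl gr w w' τ τ' : ℝ → ℝ}
    {νl νl' ν ν' νr νr' : Flux T}
    (h₁ : IsWaveSolution c T (-a) 0 f u₀ v₀ gl w νl ν u₁)
    (h₁' : IsWaveSolution c T (-a) 0 f u₀ v₀ gl w' νl' ν' u₁')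
    (h₂ : IsWaveSolution c T 0 b f u₀ v₀ τ gr (-ν) νr u₂)
    (h₂' : IsWaveSolution c T 0 b f u₀ v₀ τ' gr (-ν') νr' u₂')
    (η : timeTest T) :
    ∫ t in Ioo 0 T,
      ((w t - w' t) * ((η : ℝ → ℝ) (t + 2 * (a / c) + 2 * (b / c)) - (η : ℝ → ℝ) (t + 2 * (a / c))
        + (η : ℝ → ℝ) (t + 2 * (b / c)) - (η : ℝ → ℝ) t)
      + (τ t - τ' t) * ((η : ℝ → ℝ) (t + 2 * (a / c) + 2 * (b / c))
        - (η : ℝ → ℝ) (t + 2 * (b / c)) + (η : ℝ → ℝ) (t + 2 * (a / c)) - (η : ℝ → ℝ) t)) = 0 := by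
  obtain ⟨Θ, hΘ⟩ := timeTest.exists_primitive η
  obtain ⟨S, hS, hS0⟩ := Θ.2.2
  have hA : 0 < a / c := by positivity
  have hB : 0 < b / c := by positivity
  set A := a / c with hAdef
  set B := b / c with hBdef
  have hΘc := Θ.2.1
  have hηc := η.2.1.continuous
  have hdF : ∀ k l s : ℝ, deriv (fun s => (Θ : ℝ → ℝ) (s + k) - (Θ : ℝ → ℝ) (s + l)) s =
      (η : ℝ → ℝ) (s + k) - (η : ℝ → ℝ) (s + l) := fun k l s =>
    (((hΘ _).comp_add_const s k).sub ((hΘ _).comp_add_const s l)).deriv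
  -- φ vanishes at -a and ψ at b, which removes the outer fluxes. The profiles are chosen so that
  -- both waves have, up to sign, the same trace Θ(t+2A+2B) - Θ(t+2A) - Θ(t+2B) + Θ(t) at 0. The
  -- shift by at least A (resp. B) compensates the travel time, so that φ (resp. ψ) still vanishes
  -- near T.
  obtain ⟨φ, hφ⟩ := TestFn.exists_odd_wave (T := T) (r := -a) (S := S - A) hc ha
    (F := fun s => (Θ : ℝ → ℝ) (s + (A + 2 * B)) - (Θ : ℝ → ℝ) (s + A)) (by fun_prop)
    (by linarith) (fun s hs => by rw [hS0 _ (by linarith), hS0 _ (by linarith), sub_zero])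
  obtain ⟨ψ, hψ⟩ := TestFn.exists_odd_wave (T := T) (r := b) (S := S - B) hc hb
    (F := fun s => (Θ : ℝ → ℝ) (s + (2 * A + B)) - (Θ : ℝ → ℝ) (s + B)) (by fun_prop)
    (by linarith) (fun s hs => by rw [hS0 _ (by linarith), hS0 _ (by linarith), sub_zero])
  simp only [hdF] at hφ hψ
  have hφa : φ.slice (-a) = 0 := by
    ext t
    refine (hφ (-a) (by simp [ha.le]) t).1.trans ?_
    simp
  have hψb : ψ.slice b = 0 := by
    ext t
    refine (hψ b (by simp [hb.le]) t).1.trans ?_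
    simp
  have hφ0 := hφ 0 (by simp [abs_of_pos ha])
  have hψ0 := hψ 0 (by simp [abs_of_pos hb])
  have e1 : (0 - -a) / c = A := by rw [hAdef]; ring
  have e2 : (0 - b) / c = -B := by rw [hBdef]; ring
  simp only [e1] at hφ0
  simp only [e2] at hψ0
  -- Opposite traces let the unknown flux difference ν - ν' cancel when the two Green formulas are
  -- added.
  have hslice : ψ.slice 0 = -φ.slice 0 := by
    ext t
    refine (hψ0 t).1.trans ((congrArg Neg.neg (hφ0 t).1).trans ?_).symm
    ring_nf
  have hw1 : ∫ z in Ioo (-a) 0 ×ˢ Ioo 0 T, (u₁ z.1 z.2 - u₁' z.1 z.2) * φ.wave c z.1 z.2 = 0 := by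
    refine setIntegral_eq_zero_of_forall_eq_zero fun z hz => ?_
    rw [(hφ z.1 (abs_le.2 ⟨by linarith [hz.1.1], by linarith [hz.1.2]⟩) z.2).2.2, mul_zero]
  have hw2 : ∫ z in Ioo 0 b ×ˢ Ioo 0 T, (u₂ z.1 z.2 - u₂' z.1 z.2) * ψ.wave c z.1 z.2 = 0 := by
    refine setIntegral_eq_zero_of_forall_eq_zero fun z hz => ?_
    rw [(hψ z.1 (abs_le.2 ⟨by linarith [hz.1.1], by linarith [hz.1.2]⟩) z.2).2.2, mul_zero]
  have g1 := h₁.green_sub h₁' φ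
  have g2 := h₂.green_sub h₂' ψ
  rw [hw1] at g1
  rw [hw2] at g2
  simp only [hφa, hψb, hslice, map_zero, sub_self, zero_mul, integral_zero, add_zero, zero_add,
    mul_zero, map_neg, LinearMap.sub_apply, LinearMap.neg_apply] at g1 g2
  have k1 : ∫ t in Ioo 0 T, (w t - w' t) * φ.dx 0 t = ν (φ.slice 0) - ν' (φ.slice 0) := by
    have := (mul_eq_zero.1 g1.symm).resolve_left (by positivity)
    linarith
  have k2 : ∫ t in Ioo 0 T, (τ t - τ' t) * ψ.dx 0 t = -(ν (φ.slice 0) - ν' (φ.slice 0)) := by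
    have := (mul_eq_zero.1 g2.symm).resolve_left (by positivity)
    linarith
  have i1 : IntegrableOn (fun t => (w t - w' t) * φ.dx 0 t) (Ioo 0 T) :=
    integrableOn_mul_continuous (h₁.integrable_right.sub h₁'.integrable_right) (φ.continuous_dx 0)
  have i2 : IntegrableOn (fun t => (τ t - τ' t) * ψ.dx 0 t) (Ioo 0 T) :=
    integrableOn_mul_continuous (h₂.integrable_left.sub h₂'.integrable_left) (ψ.continuous_dx 0)
  have k3 := integral_add i1 i2
  rw [k1, k2, add_neg_cancel] at k3
  -- The factor c clears the 1/c in the x-derivatives of the waves.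
  have k4 := congrArg (c * ·) k3
  simp only [mul_zero, ← integral_const_mul] at k4
  refine Eq.trans (integral_congr_ae (Eventually.of_forall fun t => ?_)) k4
  simp only [(hφ0 t).2.1, (hψ0 t).2.1]
  have i1 : t + A + (A + 2 * B) = t + 2 * A + 2 * B := by ring
  have i2 : t + A + A = t + 2 * A := by ring
  have i3 : t - A + (A + 2 * B) = t + 2 * B := by ring
  have i4 : t - A + A = t := by ring
  have j1 : t + -B + (2 * A + B) = t + 2 * A := by ring
  have j2 : t + -B + B = t := by ring
  have j3 : t - -B + (2 * A + B) = t + 2 * A + 2 * B := by ring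
  have j4 : t - -B + B = t + 2 * B := by ring
  rw [i1, i2, i3, i4, j1, j2, j3, j4]
  field_simp
  ring

/-- If the jump `d` vanishes before time `s`, then the jump `d'` of the next step vanishes before
time `s + m`, where `m` bounds the travel times `2 A` and `2 B` from below. -/
theorem jump_vanishes {T A B m s : ℝ} (hm : 0 < m) (hA : m ≤ 2 * A) (hB : m ≤ 2 * B)
    {d d' e e' : ℝ → ℝ} (hd' : IntegrableOn d' (Ioo 0 T))
    (he : ∀ᵐ t ∂(volume.restrict (Ioo 0 T)), e t = -(d t / 2))
    (he' : ∀ᵐ t ∂(volume.restrict (Ioo 0 T)), e' t = d t / 2 - d' t)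
    (hrel : ∀ η : timeTest T, ∫ t in Ioo 0 T,
      (e t * ((η : ℝ → ℝ) (t + 2 * A + 2 * B) - (η : ℝ → ℝ) (t + 2 * A)
        + (η : ℝ → ℝ) (t + 2 * B) - (η : ℝ → ℝ) t)
      + e' t * ((η : ℝ → ℝ) (t + 2 * A + 2 * B)
        - (η : ℝ → ℝ) (t + 2 * B) + (η : ℝ → ℝ) (t + 2 * A) - (η : ℝ → ℝ) t)) = 0)
    (hd : ∀ᵐ t ∂(volume.restrict (Ioo 0 T)), t < s → d t = 0) :
    ∀ᵐ t ∂(volume.restrict (Ioo 0 T)), t < s + m → d' t = 0 := by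
  -- The relation also contains delayed values of d' itself, so its vanishing is propagated in time
  -- by steps of length m, up to s + m.
  have hind : ∀ n : ℕ, ∀ᵐ t ∂(volume.restrict (Ioo 0 T)), t < n * m → t < s + m → d' t = 0 := by
    intro n
    induction n with
    | zero =>
      filter_upwards [ae_restrict_mem measurableSet_Ioo] with t ht h0
      rw [Nat.cast_zero, zero_mul] at h0
      exact absurd ht.1 (not_lt.2 h0.le)
    | succ n ih =>
      have key := ae_eq_zero_of_integral_mul_timeTest (T := T)
        (s := min T (min ((n + 1 : ℕ) * m) (s + m))) hd' (min_le_left _ _) ?_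
      · filter_upwards [key, ae_restrict_mem measurableSet_Ioo] with t ht htm h1 h2 using
          ht (lt_min htm.2 (lt_min h1 h2))
      rintro η ⟨s', hs', h0⟩
      obtain ⟨-, hs2⟩ := lt_min_iff.1 hs'
      obtain ⟨hs2, hs3⟩ := lt_min_iff.1 hs2
      push_cast at hs2
      refine Eq.trans ?_ (hrel η)
      refine integral_congr_ae ?_
      filter_upwards [hd, ih, he, he'] with t htd htd' hte hte'
      rw [hte, hte']
      -- If t ≥ s or t ≥ nm, every shifted time lies beyond the support of η, and the unshifted
      -- terms sum to d' η because the contributions ±d/2 cancel. If t < s and t < nm, both jumps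
      -- are zero.
      rcases lt_or_ge t s with hts | hts
      · rw [htd hts]
        rcases lt_or_ge t (n * m) with htn | htn
        · rw [htd' htn (by linarith)]
          ring
        · rw [h0 (t + 2 * A + 2 * B) (by linarith), h0 (t + 2 * A) (by linarith),
            h0 (t + 2 * B) (by linarith)]
          ring
      · rw [h0 (t + 2 * A + 2 * B) (by linarith), h0 (t + 2 * A) (by linarith),
          h0 (t + 2 * B) (by linarith)]
        ring
  obtain ⟨n, hn⟩ := exists_nat_gt (T / m)
  rw [div_lt_iff₀ hm] at hn
  filter_upwards [hind n, ae_restrict_mem measurableSet_Ioo] with t ht htm using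
    ht (htm.2.trans hn)

end DNWR

/-! ### Finite-step convergence of the algorithm -/

theorem mainTheorem1 (a b c T : ℝ) (ha : 0 < a) (hb : 0 < b) (hab : a ≠ b) (hc : 0 < c)
    (hT : 0 < T)
    (f : ℝ → ℝ → ℝ) (u₀ v₀ gl gr : ℝ → ℝ)
    (u : ℝ → ℝ → ℝ) (hu : DNWR.IsModelSolution a b c T f u₀ v₀ gl gr u)
    (h : ℕ → ℝ → ℝ) (u₁ u₂ : ℕ → ℝ → ℝ → ℝ)
    (hDNWR : DNWR.IsDNWR a b c T (1 / 2) f u₀ v₀ gl gr h u₁ u₂)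
    (k : ℕ) (hk : 1 ≤ k) (hTk : T / (k : ℝ) ≤ 2 * min (a / c) (b / c)) :
    ∀ j : ℕ, k ≤ j →
      DNWR.HasInterfaceValue a b c T f u₀ v₀ gl gr u (h j) ∧
      (∀ w : ℝ → ℝ, DNWR.HasInterfaceValue a b c T f u₀ v₀ gl gr u w →
        ∀ᵐ t ∂(MeasureTheory.volume.restrict (Set.Ioo 0 T)), h j t - w t = 0) ∧
      (∀ᵐ z ∂((MeasureTheory.volume : MeasureTheory.Measure (ℝ × ℝ)).restrict
          (Set.Ioo (-a) 0 ×ˢ Set.Ioo 0 T)), u₁ (j + 1) z.1 z.2 = u z.1 z.2) ∧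
      (∀ᵐ z ∂((MeasureTheory.volume : MeasureTheory.Measure (ℝ × ℝ)).restrict
          (Set.Ioo 0 b ×ˢ Set.Ioo 0 T)), u₂ (j + 1) z.1 z.2 = u z.1 z.2) := by
  open MeasureTheory Set Filter DNWR in
  choose νl ν νr τ h₁ h₂ hθ using hDNWR.step
  have hA : 0 < a / c := by positivity
  have hB : 0 < b / c := by positivity
  set m := 2 * min (a / c) (b / c)
  have hm0 : 0 < m := mul_pos two_pos (lt_min hA hB)
  have hmA : m ≤ 2 * (a / c) := by linarith [min_le_left (a / c) (b / c)]
  have hmB : m ≤ 2 * (b / c) := by linarith [min_le_right (a / c) (b / c)]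
  -- The jump between the two traces of iteration j + 1. The case j = 0 is void, since it concerns t
  -- < 0.
  have hjump : ∀ j : ℕ, ∀ᵐ t ∂(volume.restrict (Ioo 0 T)), t < j * m → τ j t - h j t = 0 := by
    intro j
    induction j with
    | zero =>
      filter_upwards [ae_restrict_mem measurableSet_Ioo] with t ht h0
      rw [Nat.cast_zero, zero_mul] at h0
      exact absurd ht.1 (not_lt.2 h0.le)
    | succ j ih =>
      have := jump_vanishes hm0 hmA hmB (e := fun t => h j t - h (j + 1) t)
        (e' := fun t => τ j t - τ (j + 1) t) (d' := fun t => τ (j + 1) t - h (j + 1) t)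
        ((h₂ (j + 1)).integrable_left.sub (h₁ (j + 1)).integrable_right)
        ((hθ j).mono fun t ht => by rw [ht]; ring) ((hθ j).mono fun t ht => by rw [ht]; ring)
        (interface_relation ha hb hc (h₁ j) (h₁ (j + 1)) (h₂ j) (h₂ (j + 1))) ih
      filter_upwards [this] with t ht h0
      push_cast at h0
      exact ht (by linarith)
  intro j hkj
  have hk0 : (0 : ℝ) < k := by exact_mod_cast hk
  have hTj : T ≤ j * m := by
    rw [div_le_iff₀ hk0] at hTk
    have : (k : ℝ) ≤ j := by exact_mod_cast hkj
    nlinarith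
  have hτ : ∀ᵐ t ∂(volume.restrict (Ioo 0 T)), τ j t = h j t := by
    filter_upwards [hjump j, ae_restrict_mem measurableSet_Ioo] with t ht htm
    exact sub_eq_zero.1 (ht (htm.2.trans_le hTj))
  -- The two halves put together; the value on the null set x = 0 is immaterial.
  let g : ℝ → ℝ → ℝ := fun x t => if x < 0 then u₁ (j + 1) x t else u₂ (j + 1) x t
  have mble : ∀ p q : ℝ, MeasurableSet (Ioo p q ×ˢ Ioo (0 : ℝ) T) := fun p q =>
    measurableSet_Ioo.prod measurableSet_Ioo
  have hg₁ : ∀ᵐ z ∂((volume : Measure (ℝ × ℝ)).restrict (Ioo (-a) 0 ×ˢ Ioo 0 T)),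
      u₁ (j + 1) z.1 z.2 = g z.1 z.2 := by
    filter_upwards [ae_restrict_mem (mble _ _)] with z hz
    exact (if_pos hz.1.2).symm
  have hg₂ : ∀ᵐ z ∂((volume : Measure (ℝ × ℝ)).restrict (Ioo 0 b ×ˢ Ioo 0 T)),
      u₂ (j + 1) z.1 z.2 = g z.1 z.2 := by
    filter_upwards [ae_restrict_mem (mble _ _)] with z hz
    exact (if_neg (not_lt.2 hz.1.1.le)).symm
  have hrefl : ∀ w : ℝ → ℝ, ∀ᵐ t ∂(volume.restrict (Ioo 0 T)), w t = w t := fun w =>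
    Eventually.of_forall fun _ => rfl
  have hglue := IsWaveSolution.glue (neg_lt_zero.2 ha) hb
    ((h₁ j).congr hg₁ (hrefl _) (hrefl _)) ((h₂ j).congr hg₂ hτ (hrefl _))
  obtain ⟨_, _, hsol⟩ := hu
  have hgu := hglue.unique (by linarith) hc hsol
  have sub₁ : Ioo (-a) 0 ×ˢ Ioo 0 T ⊆ Ioo (-a) b ×ˢ Ioo 0 T :=
    prod_mono (Ioo_subset_Ioo_right hb.le) subset_rfl
  have sub₂ : Ioo 0 b ×ˢ Ioo 0 T ⊆ Ioo (-a) b ×ˢ Ioo 0 T :=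
    prod_mono (Ioo_subset_Ioo_left (neg_lt_zero.2 ha).le) subset_rfl
  have hu₁ : ∀ᵐ z ∂((volume : Measure (ℝ × ℝ)).restrict (Ioo (-a) 0 ×ˢ Ioo 0 T)),
      u₁ (j + 1) z.1 z.2 = u z.1 z.2 := by
    filter_upwards [hg₁, ae_restrict_of_ae_restrict_of_subset sub₁ hgu] with z h1 h2
      using h1.trans h2
  have hu₂ : ∀ᵐ z ∂((volume : Measure (ℝ × ℝ)).restrict (Ioo 0 b ×ˢ Ioo 0 T)),
      u₂ (j + 1) z.1 z.2 = u z.1 z.2 := by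
    filter_upwards [hg₂, ae_restrict_of_ae_restrict_of_subset sub₂ hgu] with z h1 h2
      using h1.trans h2
  -- Since u agrees with the iterates almost everywhere, it inherits their trace `h j` and their
  -- opposite fluxes, which gives it an interface value.
  have hL := (h₁ j).congr hu₁ (hrefl _) (hrefl _)
  have hR := (h₂ j).congr hu₂ hτ (hrefl _)
  refine ⟨⟨_, _, _, hL, hR⟩, ?_, hu₁, hu₂⟩
  rintro w ⟨_, _, _, hwL, -⟩
  exact hL.right_value_unique (neg_lt_zero.2 ha) hc hwL
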